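/- Let $\mu\subseteq\alpha$ be Young diagrams, let $n$ be the number of boxes of the (skew) diagram $\alpha/\mu$ (an ordinary shape $\alpha$ is the case $\mu=\emptyset$), and let $[\mu,\alpha]$ be the closed interval of Young's lattice (Young diagrams ordered by containment). A standard tableau of shape $\alpha/\mu$ is a bijective filling $Q$ of the boxes of $\alpha/\mu$ with $1,\dots,n$ that increases strictly along rows (left to right) and down columns (top to bottom); $Q(b)$ denotes the entry of the box $b$ and $Q^i$ the box with entry $i$. To a maximal chain $m: \mu=x_0\lessdot x_1\lessdot\dots\lessdot x_n=\alpha$ of $[\mu,\alpha]$ associate the standard tableau $T_m$ in which the box of $x_i\setminus x_{i-1}$ has entry $i$. Fix a standard tableau $T$ of shape $\alpha/\mu$ and label each cover relation $x\lessdot y=x\cup\{b\}$ of $[\mu,\alpha]$ by $\lambda_T(x,y)=T(b)$. Then $\lambda_T$ is an EL-labeling: for all $x<y$ in $[\mu,\alpha]$, the interval $[x,y]$ has a unique maximal chain with non-decreasing label sequence, and this chain lexicographically precedes all other maximal chains of $[x,y]$. For maximal chains $m,m'$ of $[\mu,\alpha]$ write $m\to m'$ if there are $w\lessdot x'\lessdot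 z$ in $m'$ such that $w,z\in m$, $x'\notin m$, $m$ and $m'$ contain the same elements $\le w$ and the same elements $\ge z$, the chain $m\cap[w,z]$ is the unique maximal chain of $[w,z]$ with non-decreasing label sequence, and $\lambda_T(w,x')\not\le\lambda_T(x',z)$. The maximal chain descent order induced by $\lambda_T$ is the reflexive and transitive closure of $\to$ on the set of maximal chains of $[\mu,\alpha]$. For standard tableaux $Q,R$ of shape $\alpha/\mu$ write $Q\to_T R$ if for some $1\le i\le n-1$ one has $T(Q^i)<T(Q^{i+1})$ and $R=(i,i+1)Q$ is obtained from $Q$ by switching the entries $i$ and $i+1$; let $\le_T$ be the reflexive and transitive closure of $\to_T$ on the set of standard tableaux of shape $\alpha/\mu$. Then the maximal chain descent order induced by $\lambda_T$ and $\le_T$ are both partial orders, and $m\mapsto T_m$ is an isomorphism from the former onto the latter. -/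

import Mathlib

/-! ### Maximal chains, edge labelings and maximal chain descent orders

The poset `P` is meant to be finite and bounded; its maximal chains are Mathlib's `Flag P`. -/

namespace MaxChainDescent

/-- An edge labeling of `P` assigns to each cover relation `x ⋖ y` of `P` a label in `Λ`. -/
abbrev EdgeLabeling (P Λ : Type*) [PartialOrder P] : Type _ := ∀ x y : P, x ⋖ y → Λ

/-- `c` is a maximal chain of the closed interval `[x, y]`. -/
def IsMaxChainOf {P : Type*} [PartialOrder P] (x y : P) (c : Set P) : Prop :=
  Maximal (fun s : Set P => s ⊆ Set.Icc x y ∧ IsChain (· ≤ ·) s) c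

/-- `a` is the label of the cover relation of `c` that has exactly `i` elements of `c` strictly
below its bottom element: for a saturated chain `x₀ ⋖ x₁ ⋖ ⋯ ⋖ xᵣ` this is the label of
`xᵢ ⋖ xᵢ₊₁`, that is, the entry with index `i` (counted from `0`) of the label sequence of `c`. -/
def HasLabelAt {P Λ : Type*} [PartialOrder P] (lam : EdgeLabeling P Λ) (c : Set P) (i : ℕ)
    (a : Λ) : Prop :=
  ∃ (u v : P) (huv : u ⋖ v), u ∈ c ∧ v ∈ c ∧ {z ∈ c | z < u}.ncard = i ∧ lam u v huv = a

/-- The label sequence of the saturated chain `c` is non-decreasing. -/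
def IsAscending {P Λ : Type*} [PartialOrder P] [PartialOrder Λ] (lam : EdgeLabeling P Λ)
    (c : Set P) : Prop :=
  ∀ (u v w : P) (huv : u ⋖ v) (hvw : v ⋖ w), u ∈ c → v ∈ c → w ∈ c → lam u v huv ≤ lam v w hvw

/-- `c` lexicographically precedes `d`: at the first index where the label sequences disagree, the
label of `c` is strictly smaller. -/
def LexPrecedes {P Λ : Type*} [PartialOrder P] [PartialOrder Λ] (lam : EdgeLabeling P Λ)
    (c d : Set P) : Prop :=
  ∃ (i : ℕ) (a b : Λ), HasLabelAt lam c i a ∧ HasLabelAt lam d i b ∧ a < b ∧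
    ∀ j < i, ∀ a' b' : Λ, HasLabelAt lam c j a' → HasLabelAt lam d j b' → a' = b'

/-- `c` is the unique ascending maximal chain of `[x, y]`. -/
def IsUniqueAscending {P Λ : Type*} [PartialOrder P] [PartialOrder Λ] (lam : EdgeLabeling P Λ)
    (x y : P) (c : Set P) : Prop :=
  IsMaxChainOf x y c ∧ IsAscending lam c ∧
    ∀ d : Set P, IsMaxChainOf x y d → IsAscending lam d → d = c

/-- EL-labelings: every interval `[x, y]` with `x < y` has a unique ascending maximal chain, and
this chain lexicographically precedes all other maximal chains of `[x, y]`. -/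
def IsELLabeling {P Λ : Type*} [PartialOrder P] [PartialOrder Λ] (lam : EdgeLabeling P Λ) :
    Prop :=
  ∀ x y : P, x < y → ∃ c : Set P, IsUniqueAscending lam x y c ∧
    ∀ d : Set P, IsMaxChainOf x y d → d ≠ c → LexPrecedes lam c d

/-- The maximal chains `m` and `m'` differ by a polygon with bottom `w` and top `z`: they agree
weakly below `w` and weakly above `z`, and between `w` and `z` the chain `m'` is
`w ⋖ x' ⋖ z`, where `x'` does not lie on `m`. -/
def DifferByPolygon {P : Type*} [PartialOrder P] (m m' : Flag P) (w x' z : P) : Prop :=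
  w ∈ m ∧ z ∈ m ∧ w ∈ m' ∧ x' ∈ m' ∧ z ∈ m' ∧ w ⋖ x' ∧ x' ⋖ z ∧ x' ∉ m ∧
    (m : Set P) ∩ Set.Iic w = (m' : Set P) ∩ Set.Iic w ∧
    (m : Set P) ∩ Set.Ici z = (m' : Set P) ∩ Set.Ici z

/-- `m → m'`: the maximal chain `m` increases by a polygon move to `m'`. -/
def PolygonMove {P Λ : Type*} [PartialOrder P] [PartialOrder Λ] (lam : EdgeLabeling P Λ)
    (m m' : Flag P) : Prop :=
  ∃ (w x' z : P) (hw : w ⋖ x') (hz : x' ⋖ z), DifferByPolygon m m' w x' z ∧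
    IsUniqueAscending lam w z ((m : Set P) ∩ Set.Icc w z) ∧ ¬ lam w x' hw ≤ lam x' z hz

/-- The maximal chain descent order induced by `lam`, on the maximal chains of `P`: the reflexive
and transitive closure of the polygon moves. -/
def DescentLE {P Λ : Type*} [PartialOrder P] [PartialOrder Λ] (lam : EdgeLabeling P Λ) :
    Flag P → Flag P → Prop :=
  Relation.ReflTransGen (PolygonMove lam)

/-! ### Intervals of Young's lattice and standard tableaux

Young's lattice is Mathlib's `YoungDiagram`. For `μ ≤ α`, the interval is `Set.Icc μ α`, and the
shape is the skew diagram `α / μ`; an ordinary shape `α` is the case `μ = ⊥`. -/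

/-- The boxes of the skew diagram `α / μ`. -/
abbrev skewDiagram (μ α : YoungDiagram) : Finset (ℕ × ℕ) := α.cells \ μ.cells

/-- A standard tableau of shape `α / μ`: a filling of the `n` boxes with the numbers `1, …, n`,
each used exactly once, strictly increasing along rows (left to right) and down columns. -/
@[ext]
structure StandardTableau (μ α : YoungDiagram) where
  entry : skewDiagram μ α → ℕ
  bijOn : Set.BijOn entry Set.univ (Set.Icc 1 (skewDiagram μ α).card)
  row_strict : ∀ b c : skewDiagram μ α, b.1.1 = c.1.1 → b.1.2 < c.1.2 → entry b < entry c
  col_strict : ∀ b c : skewDiagram μ α, b.1.2 = c.1.2 → b.1.1 < c.1.1 → entry b < entry c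

/-- The box `Q^i` of `Q` with entry `i`. -/
noncomputable def StandardTableau.box {μ α : YoungDiagram} (Q : StandardTableau μ α) (i : ℕ)
    (hi : i ∈ Set.Icc 1 (skewDiagram μ α).card) : skewDiagram μ α :=
  (Q.bijOn.surjOn hi).choose

theorem StandardTableau.entry_box {μ α : YoungDiagram} (Q : StandardTableau μ α) (i : ℕ)
    (hi : i ∈ Set.Icc 1 (skewDiagram μ α).card) : Q.entry (Q.box i hi) = i :=
  (Q.bijOn.surjOn hi).choose_spec.2

/-- `R = (i, j) Q`: the standard tableau `R` is obtained from `Q` by switching the entries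
`i` and `j`. -/
def IsTableauSwap {μ α : YoungDiagram} (i j : ℕ) (Q R : StandardTableau μ α) : Prop :=
  ∀ b, R.entry b = Equiv.swap i j (Q.entry b)

/-- `R` is the `i`-th tableau swap `(i, i+1) Q` of `Q` for some `1 ≤ i ≤ n - 1` with
`T(Q^i) < T(Q^{i+1})`. -/
def TableauMove {μ α : YoungDiagram} (T Q R : StandardTableau μ α) : Prop :=
  ∃ (i : ℕ) (hi : i ∈ Set.Icc 1 (skewDiagram μ α).card)
    (hi' : i + 1 ∈ Set.Icc 1 (skewDiagram μ α).card),
    T.entry (Q.box i hi) < T.entry (Q.box (i + 1) hi') ∧ IsTableauSwap i (i + 1) Q R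

/-- The relation `≤_T` on standard tableaux: the reflexive and transitive closure of
`TableauMove T`. -/
def TableauLE {μ α : YoungDiagram} (T : StandardTableau μ α) :
    StandardTableau μ α → StandardTableau μ α → Prop :=
  Relation.ReflTransGen (TableauMove T)

/-- In an interval of Young's lattice, `x ⋖ y` means that `y` is obtained by adding one box. -/
theorem exists_box_of_covBy {μ α : YoungDiagram} {x y : Set.Icc μ α} (hxy : x ⋖ y) :
    ∃ b : skewDiagram μ α, b.1 ∉ x.1.cells ∧ y.1.cells = insert b.1 x.1.cells := by
  have hlt : x.1.cells ⊂ y.1.cells := hxy.lt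
  have hne : (y.1.cells \ x.1.cells).Nonempty := Finset.sdiff_nonempty.2 hlt.2
  obtain ⟨b, hb⟩ := (y.1.cells \ x.1.cells).exists_minimal hne
  have hby : b ∈ y.1.cells := (Finset.mem_sdiff.1 hb.1).1
  have hbx : b ∉ x.1.cells := (Finset.mem_sdiff.1 hb.1).2
  have hμ : μ.cells ⊆ x.1.cells := x.2.1
  have hα : y.1.cells ⊆ α.cells := y.2.2
  have hlow : IsLowerSet ((insert b x.1.cells : Finset (ℕ × ℕ)) : Set (ℕ × ℕ)) := by
    intro p q hqp hp
    simp only [Finset.coe_insert, Set.mem_insert_iff, Finset.mem_coe] at hp ⊢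
    rcases hp with rfl | hp
    · by_cases hq : q ∈ x.1.cells
      · exact Or.inr hq
      · have hqy : q ∈ y.1.cells := y.1.isLowerSet hqp hby
        exact Or.inl (le_antisymm hqp (hb.2 (Finset.mem_sdiff.2 ⟨hqy, hq⟩) hqp))
    · exact Or.inr (x.1.isLowerSet hqp hp)
  let z : YoungDiagram := ⟨insert b x.1.cells, hlow⟩
  have hzy : z.cells ⊆ y.1.cells := Finset.insert_subset hby hlt.1
  have hxz : x.1.cells ⊆ z.cells := Finset.subset_insert _ _
  let z' : Set.Icc μ α := ⟨z, hμ.trans hxz, hzy.trans hα⟩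
  have h1 : x < z' := by
    refine lt_of_le_of_ne hxz fun h => hbx ?_
    rw [h]
    exact Finset.mem_insert_self _ _
  refine ⟨⟨b, Finset.mem_sdiff.2 ⟨hα hby, fun h => hbx (hμ h)⟩⟩, hbx, ?_⟩
  have h2 : z' = y := by
    by_contra hne'
    exact hxy.2 h1 (lt_of_le_of_ne hzy hne')
  rw [← h2]

/-- The edge labeling `λ_T` of the interval `[μ, α]`: the label of `x ⋖ y = x ∪ {b}` is `T(b)`. -/
noncomputable def tableauLabeling {μ α : YoungDiagram} (T : StandardTableau μ α) :
    EdgeLabeling (Set.Icc μ α) ℕ :=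
  fun _ _ hxy => T.entry (exists_box_of_covBy hxy).choose

theorem finite_interval (μ α : YoungDiagram) : Finite (Set.Icc μ α) := by
  refine Finite.of_injective
    (fun x : Set.Icc μ α => (⟨x.1.cells, Finset.mem_powerset.2 x.2.2⟩ : α.cells.powerset)) ?_
  intro x y hxy
  exact Subtype.ext (YoungDiagram.ext (congrArg Subtype.val hxy))

/-- The filling of `α / μ` given by a maximal chain `x₀ ⋖ x₁ ⋖ ⋯ ⋖ xₙ` of `[μ, α]`: the box `b`
added in the step from `xᵢ₋₁` to `xᵢ` gets the entry `i`, which is the number of elements of the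
chain (namely `x₀, …, xᵢ₋₁`) that do not contain `b`. -/
noncomputable def chainEntry {μ α : YoungDiagram} (m : Flag (Set.Icc μ α))
    (b : skewDiagram μ α) : ℕ :=
  {x : Set.Icc μ α | x ∈ m ∧ b.1 ∉ x.1.cells}.ncard

theorem bot_mem_chain {μ α : YoungDiagram} (h : μ ≤ α) (m : Flag (Set.Icc μ α)) :
    (⟨μ, le_refl μ, h⟩ : Set.Icc μ α) ∈ m := by
  have := m.maxChain.2 (m.chain_le.insert (a := (⟨μ, le_refl μ, h⟩ : Set.Icc μ α))
    fun b _ _ => Or.inl b.2.1) (Set.subset_insert _ _)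
  exact this.ge (Set.mem_insert _ _)

theorem top_mem_chain {μ α : YoungDiagram} (h : μ ≤ α) (m : Flag (Set.Icc μ α)) :
    (⟨α, h, le_refl α⟩ : Set.Icc μ α) ∈ m := by
  have := m.maxChain.2 (m.chain_le.insert (a := (⟨α, h, le_refl α⟩ : Set.Icc μ α))
    fun b _ _ => Or.inr b.2.2) (Set.subset_insert _ _)
  exact this.ge (Set.mem_insert _ _)

/-- Any two boxes are separated by some element of a maximal chain. -/
theorem exists_separating {μ α : YoungDiagram} (h : μ ≤ α) (m : Flag (Set.Icc μ α))
    {b c : skewDiagram μ α} (hbc : b ≠ c) :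
    ∃ x ∈ m, (b.1 ∈ x.1.cells ∧ c.1 ∉ x.1.cells) ∨ (c.1 ∈ x.1.cells ∧ b.1 ∉ x.1.cells) := by
  have := finite_interval μ α
  have hbα : b.1 ∈ α.cells := (Finset.mem_sdiff.1 b.2).1
  have hbμ : b.1 ∉ μ.cells := (Finset.mem_sdiff.1 b.2).2
  have hcμ : c.1 ∉ μ.cells := (Finset.mem_sdiff.1 c.2).2
  obtain ⟨x, hx⟩ := (Set.toFinite
    {x : Set.Icc μ α | x ∈ m ∧ b.1 ∉ x.1.cells ∧ c.1 ∉ x.1.cells}).exists_maximal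
    ⟨_, bot_mem_chain h m, hbμ, hcμ⟩
  obtain ⟨hxm, hbx, hcx⟩ := hx.1
  have hxα : x < ⟨α, h, le_refl α⟩ :=
    lt_of_le_of_ne x.2.2 fun h' => hbx (by rw [h']; exact hbα)
  obtain ⟨y, hy⟩ := (Set.toFinite {y : Set.Icc μ α | y ∈ m ∧ x < y}).exists_minimal
    ⟨_, top_mem_chain h m, hxα⟩
  obtain ⟨hym, hxy⟩ := hy.1
  have hcov : x ⋖ y := by
    have : (⟨x, hxm⟩ : m) ⋖ ⟨y, hym⟩ := by
      refine ⟨hxy, fun z hxz hzy => ?_⟩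
      exact absurd (hy.2 ⟨z.2, hxz⟩ hzy.le) (not_le_of_gt hzy)
    exact Flag.coe_covBy_coe.2 this
  obtain ⟨d, -, hd⟩ := exists_box_of_covBy hcov
  have hor : b.1 ∈ y.1.cells ∨ c.1 ∈ y.1.cells := by
    by_contra hcon
    push Not at hcon
    exact absurd (hx.2 ⟨hym, hcon.1, hcon.2⟩ hxy.le) (not_le_of_gt hxy)
  have hnot : ¬ (b.1 ∈ y.1.cells ∧ c.1 ∈ y.1.cells) := by
    rintro ⟨h1, h2⟩
    rw [hd, Finset.mem_insert] at h1 h2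
    exact hbc (Subtype.ext ((h1.resolve_right hbx).trans (h2.resolve_right hcx).symm))
  exact ⟨y, hym, by tauto⟩

theorem chainEntry_lt {μ α : YoungDiagram} (m : Flag (Set.Icc μ α))
    {b c : skewDiagram μ α} {x : Set.Icc μ α} (hx : x ∈ m) (hb : b.1 ∈ x.1.cells)
    (hc : c.1 ∉ x.1.cells) : chainEntry m b < chainEntry m c := by
  have := finite_interval μ α
  refine Set.ncard_lt_ncard ⟨?_, fun hsub => (hsub ⟨hx, hc⟩).2 hb⟩ (Set.toFinite _)
  rintro y ⟨hy, hby⟩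
  refine ⟨hy, fun hcy => ?_⟩
  rcases m.le_or_le hx hy with hxy | hyx
  · exact hby (hxy hb)
  · exact hc (hyx hcy)

theorem chainEntry_lt_of_lt {μ α : YoungDiagram} (h : μ ≤ α) (m : Flag (Set.Icc μ α))
    {b c : skewDiagram μ α} (hbc : b.1 < c.1) : chainEntry m b < chainEntry m c := by
  obtain ⟨x, hx, h1 | h1⟩ := exists_separating h m (b := b) (c := c)
    (fun h' => hbc.ne (congrArg Subtype.val h'))
  · exact chainEntry_lt m hx h1.1 h1.2
  · exact absurd (x.1.isLowerSet hbc.le h1.1) h1.2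

theorem chainEntry_injective {μ α : YoungDiagram} (h : μ ≤ α) (m : Flag (Set.Icc μ α)) :
    Function.Injective (chainEntry m) := by
  intro b c hbc
  by_contra hne
  obtain ⟨x, hx, h1 | h1⟩ := exists_separating h m hne
  · exact (chainEntry_lt m hx h1.1 h1.2).ne hbc
  · exact (chainEntry_lt m hx h1.1 h1.2).ne hbc.symm

theorem chainEntry_mem {μ α : YoungDiagram} (h : μ ≤ α) (m : Flag (Set.Icc μ α))
    (b : skewDiagram μ α) : chainEntry m b ∈ Set.Icc 1 (skewDiagram μ α).card := by
  have := finite_interval μ α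
  have hbα : b.1 ∈ α.cells := (Finset.mem_sdiff.1 b.2).1
  have hbμ : b.1 ∉ μ.cells := (Finset.mem_sdiff.1 b.2).2
  constructor
  · exact (Set.ncard_pos (Set.toFinite _)).2 ⟨_, bot_mem_chain h m, hbμ⟩
  · have key : chainEntry m b ≤ (Finset.range (skewDiagram μ α).card : Set ℕ).ncard := by
      refine Set.ncard_le_ncard_of_injOn (fun x : Set.Icc μ α => (x.1.cells \ μ.cells).card)
        ?_ ?_ (Finset.finite_toSet _)
      · rintro x ⟨hx, hbx⟩
        simp only [Finset.coe_range, Set.mem_Iio]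
        refine Finset.card_lt_card ⟨Finset.sdiff_subset_sdiff x.2.2 (Finset.Subset.refl _),
          fun hsub => hbx ?_⟩
        exact (Finset.mem_sdiff.1 (hsub b.2)).1
      · have aux : ∀ x y : Set.Icc μ α, x ≤ y →
            (x.1.cells \ μ.cells).card = (y.1.cells \ μ.cells).card → x = y := by
          intro x y hxy hcard
          have hsub : x.1.cells ⊆ y.1.cells := hxy
          have heq := Finset.eq_of_subset_of_card_le
            (Finset.sdiff_subset_sdiff hsub (Finset.Subset.refl μ.cells)) hcard.ge
          refine Subtype.ext (YoungDiagram.ext ?_)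
          have h1 : μ.cells ⊆ x.1.cells := x.2.1
          have h2 : μ.cells ⊆ y.1.cells := y.2.1
          rw [← Finset.sdiff_union_of_subset h1, heq, Finset.sdiff_union_of_subset h2]
        rintro x ⟨hx, -⟩ y ⟨hy, -⟩ hxy
        rcases m.le_or_le hx hy with hle | hle
        · exact aux x y hle hxy
        · exact (aux y x hle hxy.symm).symm
    rwa [Set.ncard_coe_finset, Finset.card_range] at key

/-- The standard tableau `T_m` of shape `α / μ` corresponding to the maximal chain `m` of
`[μ, α]`. -/
noncomputable def chainTableau {μ α : YoungDiagram} (h : μ ≤ α) (m : Flag (Set.Icc μ α)) :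
    StandardTableau μ α where
  entry := chainEntry m
  bijOn := by
    refine ⟨fun b _ => chainEntry_mem h m b, (chainEntry_injective h m).injOn, ?_⟩
    have hmaps : ∀ b ∈ (Finset.univ : Finset (skewDiagram μ α)),
        chainEntry m b ∈ Finset.Icc 1 (skewDiagram μ α).card := fun b _ =>
      Finset.mem_Icc.2 (chainEntry_mem h m b)
    have hs := Finset.surjOn_of_injOn_of_card_le (chainEntry m) hmaps
      (chainEntry_injective h m).injOn (by simp)
    simpa using hs
  row_strict := fun b c h1 h2 => chainEntry_lt_of_lt h m
    (Prod.lt_iff.2 (Or.inr ⟨h1.le, h2⟩))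
  col_strict := fun b c h1 h2 => chainEntry_lt_of_lt h m
    (Prod.lt_iff.2 (Or.inl ⟨h2, h1.le⟩))

end MaxChainDescent

/-! A maximal chain of `[x, y]` is an order in which the boxes of `y \ x` are added, and its labels
are the `T`-entries of these boxes. Adding the boxes by increasing entry is always possible, because
boxes with small entries form a diagram together with `x`. This gives the chain `initialChain`,
defined without indices: each of its elements separates added boxes from missing ones by entry. It
is ascending; an ascending chain must follow it (`IsMaxChainOf.eq_initialChain`); and a chain that
branches off adds a box of larger entry at that point. This is the EL property.

The same construction, with an arbitrary tableau `Q` in place of `T` on all of `[μ, α]`, inverts `m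
↦ T_m` (`chainTableauEquiv`).

A polygon move replaces one element `w ∪ {b}` of a chain by `w ∪ {c}`, so it exchanges two
consecutive additions `b`, `c`. The descent on the new side says `T(b) < T(c)`, which is exactly a
tableau move (`polygonMove_iff_tableauMove`). Hence the two closures correspond. Antisymmetry comes
from the potential `∑ T(b) Q(b)`, which every tableau move strictly decreases
(`TableauMove.sum_lt`); it is then carried over to chains along the isomorphism. -/

namespace MaxChainDescent

/-! ### Maximal chains of intervals -/

section Chains

variable {P : Type*} [PartialOrder P] {x y : P} {c d : Set P}

theorem IsMaxChainOf.mem_of_comparable (hc : IsMaxChainOf x y c) {t : P} (ht : t ∈ Set.Icc x y)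
    (hcomp : ∀ s ∈ c, t ≤ s ∨ s ≤ t) : t ∈ c :=
  hc.2 (y := insert t c)
    ⟨Set.insert_subset ht hc.1.1, hc.1.2.insert fun s hs _ => hcomp s hs⟩
    (Set.subset_insert _ _) (Set.mem_insert _ _)

theorem IsMaxChainOf.le_or_le (hc : IsMaxChainOf x y c) {s t : P} (hs : s ∈ c) (ht : t ∈ c) :
    s ≤ t ∨ t ≤ s :=
  hc.1.2.total hs ht

theorem IsMaxChainOf.left_mem (hc : IsMaxChainOf x y c) (hxy : x ≤ y) : x ∈ c :=
  hc.mem_of_comparable ⟨le_rfl, hxy⟩ fun _ hs => Or.inl (hc.1.1 hs).1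

theorem IsMaxChainOf.right_mem (hc : IsMaxChainOf x y c) (hxy : x ≤ y) : y ∈ c :=
  hc.mem_of_comparable ⟨hxy, le_rfl⟩ fun _ hs => Or.inr (hc.1.1 hs).2

/-- The next element of the chain covers `u` in all of `P`: anything strictly between would be
comparable with the whole chain, hence in it. -/
theorem IsMaxChainOf.exists_covBy [Finite P] (hc : IsMaxChainOf x y c) {u v : P} (hu : u ∈ c)
    (hv : v ∈ c) (huv : u < v) : ∃ t ∈ c, u ⋖ t ∧ t ≤ v := by
  obtain ⟨t, ht⟩ := (Set.toFinite {t : P | t ∈ c ∧ u < t}).exists_minimal ⟨v, hv, huv⟩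
  have hmin : ∀ s ∈ c, u < s → t ≤ s := fun s hs hus =>
    (hc.le_or_le ht.1.1 hs).elim id fun h => ht.2 ⟨hs, hus⟩ h
  refine ⟨t, ht.1.1, ⟨ht.1.2, fun r hur hrt => ?_⟩, hmin v hv huv⟩
  have hr : r ∈ c := by
    refine hc.mem_of_comparable
      ⟨(hc.1.1 hu).1.trans hur.le, hrt.le.trans (hc.1.1 ht.1.1).2⟩ fun s hs => ?_
    rcases hc.le_or_le hs hu with h | h
    · exact Or.inr (h.trans hur.le)
    · rcases h.eq_or_lt with rfl | h
      · exact Or.inr hur.le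
      · exact Or.inl (hrt.le.trans (hmin s hs h))
  exact absurd (hmin r hr hur) (not_le_of_gt hrt)

theorem IsMaxChainOf.covBy_unique (hc : IsMaxChainOf x y c) {u v w : P} (hv : v ∈ c) (hw : w ∈ c)
    (huv : u ⋖ v) (huw : u ⋖ w) : v = w := by
  rcases hc.le_or_le hv hw with h | h
  · exact h.eq_or_lt.resolve_right fun h' => huw.2 huv.lt h'
  · exact (h.eq_or_lt.resolve_right fun h' => huv.2 huw.lt h').symm

theorem IsMaxChainOf.eq_of_subset (hc : IsMaxChainOf x y c) (hd : IsMaxChainOf x y d)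
    (h : c ⊆ d) : c = d :=
  h.antisymm (hc.2 hd.1 h)

/-- An element of `[w, z]` is automatically comparable with the part of `m` below `w` or above `z`,
so only the part inside the interval can obstruct adding it. -/
theorem isMaxChainOf_inter_Icc (m : Flag P) {w z : P} (hw : w ∈ m) (hz : z ∈ m) :
    IsMaxChainOf w z ((m : Set P) ∩ Set.Icc w z) := by
  refine ⟨⟨Set.inter_subset_right, m.chain_le.mono Set.inter_subset_left⟩, ?_⟩
  rintro s ⟨hs, hchain⟩ hsub t ht
  refine ⟨?_, hs ht⟩
  have := m.maxChain.2 (m.chain_le.insert (a := t) fun r hr _ => ?_) (Set.subset_insert _ _)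
  · exact this.ge (Set.mem_insert _ _)
  · rcases m.le_or_le hr hw with h | h
    · exact Or.inr (h.trans (hs ht).1)
    rcases m.le_or_le hz hr with h' | h'
    · exact Or.inl ((hs ht).2.trans h')
    exact hchain.total ht (hsub ⟨hr, h, h'⟩)

theorem le_or_le_of_covBy_covBy (m : Flag P) {w u z t : P} (hw : w ∈ m) (hu : u ∈ m) (hz : z ∈ m)
    (hwu : w ⋖ u) (huz : u ⋖ z) (ht : t ∈ m) (htu : t ≠ u) : t ≤ w ∨ z ≤ t := by
  rcases m.le_or_le ht hu with h | h
  · refine Or.inl ((m.le_or_le ht hw).elim id fun h' => ?_)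
    rcases h'.eq_or_lt with rfl | h'
    · exact le_rfl
    · exact absurd (lt_of_le_of_ne h htu) (hwu.2 h')
  · refine Or.inr ((m.le_or_le hz ht).elim id fun h' => ?_)
    rcases h'.eq_or_lt with rfl | h'
    · exact le_rfl
    · exact absurd h' (huz.2 (lt_of_le_of_ne h htu.symm))

/-! ### Label sequences and lexicographic comparison. -/

variable {Λ : Type*} [PartialOrder Λ] {lam : EdgeLabeling P Λ}

/-- Along an ascending maximal chain, labels further up are at least as large. -/
theorem IsAscending.label_le [Finite P] (hasc : IsAscending lam d) (hd : IsMaxChainOf x y d)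
    {u v : P} (huv : u ⋖ v) (hu : u ∈ d) (hv : v ∈ d) {s t : P} (hst : s ⋖ t) (hs : s ∈ d)
    (ht : t ∈ d) (hvs : v ≤ s) : lam u v huv ≤ lam s t hst := by
  -- Induction from the top down: the hypothesis is used for the successor `r` of `v` in the chain.
  induction v using WellFoundedGT.induction generalizing u with
  | _ v ih =>
    rcases hvs.eq_or_lt with rfl | hlt
    · exact hasc u v t huv hst hu hv ht
    · obtain ⟨r, hr, hvr, hrs⟩ := hd.exists_covBy hv hs hlt
      exact (hasc u v r huv hvr hu hv hr).trans (ih r hvr.lt hvr hv hr hrs)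

/-- Positions in a chain increase strictly, so the index in `HasLabelAt` determines the bottom
element of the step. -/
theorem ncard_below_lt [Finite P] {p q : P} (hp : p ∈ c) (h : p < q) :
    {z ∈ c | z < p}.ncard < {z ∈ c | z < q}.ncard :=
  Set.ncard_lt_ncard ⟨fun _ hz => ⟨hz.1, hz.2.trans h⟩,
    fun hsub => lt_irrefl p (hsub ⟨hp, h⟩).2⟩ (Set.toFinite _)

/-- Two distinct maximal chains of an interval agree up to some element and then branch. -/
theorem IsMaxChainOf.exists_branching [Finite P] (hxy : x ≤ y) (hc : IsMaxChainOf x y c)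
    (hd : IsMaxChainOf x y d) (hne : d ≠ c) :
    ∃ u ∈ c, u ∈ d ∧ (∀ t ≤ u, t ∈ c ↔ t ∈ d) ∧
      ∃ v ∈ c, ∃ v' ∈ d, u ⋖ v ∧ u ⋖ v' ∧ v ≠ v' := by
  obtain ⟨u, hu⟩ := (Set.toFinite {u : P | u ∈ c ∧ u ∈ d ∧ ∀ t ≤ u, t ∈ c ↔ t ∈ d}).exists_maximal
    ⟨x, hc.left_mem hxy, hd.left_mem hxy, fun t ht => by
      constructor
      · intro h; rw [ht.antisymm (hc.1.1 h).1]; exact hd.left_mem hxy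
      · intro h; rw [ht.antisymm (hd.1.1 h).1]; exact hc.left_mem hxy⟩
  obtain ⟨huc, hud, hagree⟩ := hu.1
  have huy : u < y := by
    refine lt_of_le_of_ne (hc.1.1 huc).2 ?_
    rintro rfl
    exact hne (Set.ext fun t => ⟨fun h => (hagree t (hd.1.1 h).2).2 h,
      fun h => (hagree t (hc.1.1 h).2).1 h⟩)
  obtain ⟨v, hv, huv, -⟩ := hc.exists_covBy huc (hc.right_mem hxy) huy
  obtain ⟨v', hv', huv', -⟩ := hd.exists_covBy hud (hd.right_mem hxy) huy
  refine ⟨u, huc, hud, hagree, v, hv, v', hv', huv, huv', ?_⟩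
  rintro rfl
  -- If both chains continued with the same `v`, they would agree up to `v`, against the maximality
  -- of `u`.
  refine absurd (hu.2 ⟨hv, hv', fun t ht => ?_⟩ huv.le) (not_le_of_gt huv.lt)
  have key : ∀ e : Set P, IsMaxChainOf x y e → u ∈ e → t ∈ e → t ≤ u ∨ t = v := by
    intro e he hue hte
    rcases he.le_or_le hte hue with h | h
    · exact Or.inl h
    · rcases h.eq_or_lt with rfl | h
      · exact Or.inl le_rfl
      · exact Or.inr (ht.eq_or_lt.resolve_right fun h' => huv.2 h h')
  constructor
  · intro h
    rcases key c hc huc h with h' | rfl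
    exacts [(hagree t h').1 h, hv']
  · intro h
    rcases key d hd hud h with h' | rfl
    exacts [(hagree t h').2 h, hv]

/-- The deciding index is the number of elements below `u`; every earlier index belongs to a step
that both chains share. -/
theorem LexPrecedes.of_branching [Finite P] (hc : IsMaxChainOf x y c) (hd : IsMaxChainOf x y d)
    {u v v' : P} (huc : u ∈ c) (hud : u ∈ d) (hagree : ∀ t ≤ u, t ∈ c ↔ t ∈ d) (hv : v ∈ c)
    (hv' : v' ∈ d) (huv : u ⋖ v) (huv' : u ⋖ v') (hlt : lam u v huv < lam u v' huv') :
    LexPrecedes lam c d := by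
  have hbelow : ∀ t ≤ u, {z ∈ c | z < t} = {z ∈ d | z < t} := fun t ht =>
    Set.ext fun z => and_congr_left fun hz => hagree z (hz.le.trans ht)
  refine ⟨{z ∈ c | z < u}.ncard, _, _, ⟨u, v, huv, huc, hv, rfl, rfl⟩,
    ⟨u, v', huv', hud, hv', by rw [hbelow u le_rfl], rfl⟩, hlt, ?_⟩
  rintro j hj a b ⟨p, q, hpq, hp, hq, hpj, rfl⟩ ⟨p', q', hpq', hp', hq', hpj', rfl⟩
  have hpu : p < u := by
    rcases hc.le_or_le huc hp with h | h
    · rcases h.eq_or_lt with rfl | h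
      · omega
      · have := ncard_below_lt huc h
        omega
    · exact lt_of_le_of_ne h (by rintro rfl; omega)
  have hpu' : p' < u := by
    rw [hbelow u le_rfl] at hj
    rcases hd.le_or_le hud hp' with h | h
    · rcases h.eq_or_lt with rfl | h
      · omega
      · have := ncard_below_lt hud h
        omega
    · exact lt_of_le_of_ne h (by rintro rfl; omega)
  have hp'c : p' ∈ c := (hagree p' hpu'.le).2 hp'
  rw [← hbelow p' hpu'.le] at hpj'
  obtain rfl : p = p' := by
    rcases hc.le_or_le hp hp'c with h | h
    · refine h.eq_or_lt.resolve_right fun h' => ?_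
      have := ncard_below_lt hp h'
      omega
    · refine (h.eq_or_lt.resolve_right fun h' => ?_).symm
      have := ncard_below_lt hp'c h'
      omega
  have hqu : q ≤ u := (hc.le_or_le hq huc).elim id fun h => by
    rcases h.eq_or_lt with rfl | h
    · exact le_rfl
    · exact absurd h (hpq.2 hpu)
  obtain rfl : q = q' := hd.covBy_unique ((hagree q hqu).1 hq) hq' hpq hpq'
  rfl

end Chains

/-! ### Boxes and intervals of Young's lattice -/

section Young

variable {μ α : YoungDiagram} {x y : Set.Icc μ α}

theorem le_iff_boxes : x ≤ y ↔ ∀ b : skewDiagram μ α, b.1 ∈ x.1.cells → b.1 ∈ y.1.cells := by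
  refine ⟨fun h b hb => h hb, fun h p hp => ?_⟩
  by_cases hpμ : p ∈ μ.cells
  · exact y.2.1 hpμ
  · exact h ⟨p, Finset.mem_sdiff.2 ⟨x.2.2 hp, hpμ⟩⟩ hp

theorem eq_iff_boxes : x = y ↔ ∀ b : skewDiagram μ α, b.1 ∈ x.1.cells ↔ b.1 ∈ y.1.cells :=
  ⟨fun h b => by rw [h], fun h => le_antisymm (le_iff_boxes.2 fun b => (h b).1)
    (le_iff_boxes.2 fun b => (h b).2)⟩

theorem exists_box_of_not_le (h : ¬ x ≤ y) :
    ∃ b : skewDiagram μ α, b.1 ∈ x.1.cells ∧ b.1 ∉ y.1.cells := by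
  rw [le_iff_boxes] at h
  push Not at h
  exact h

theorem covBy_of_boxes {b : skewDiagram μ α} (hb : b.1 ∉ x.1.cells)
    (h : ∀ d : skewDiagram μ α, d.1 ∈ y.1.cells ↔ d = b ∨ d.1 ∈ x.1.cells) : x ⋖ y := by
  refine ⟨lt_of_le_of_ne (le_iff_boxes.2 fun d hd => (h d).2 (Or.inr hd)) fun he => hb ?_, ?_⟩
  · rw [he]
    exact (h b).2 (Or.inl rfl)
  · intro z hxz hzy
    by_cases hbz : b.1 ∈ z.1.cells
    · refine not_le_of_gt hzy (le_iff_boxes.2 fun d hd => ?_)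
      rcases (h d).1 hd with rfl | hd
      exacts [hbz, hxz.le hd]
    · refine not_le_of_gt hxz (le_iff_boxes.2 fun d hd => ?_)
      rcases (h d).1 (hzy.le hd) with rfl | hd'
      exacts [absurd hd hbz, hd']

theorem exists_box_iff_of_covBy (hxy : x ⋖ y) :
    ∃ b : skewDiagram μ α, b.1 ∉ x.1.cells ∧
      ∀ d : skewDiagram μ α, d.1 ∈ y.1.cells ↔ d = b ∨ d.1 ∈ x.1.cells := by
  obtain ⟨b, hb, hy⟩ := exists_box_of_covBy hxy
  exact ⟨b, hb, fun d => by rw [hy, Finset.mem_insert, Subtype.ext_iff]⟩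

/-- Frees the label from the choice of box in its definition. -/
theorem tableauLabeling_eq (T : StandardTableau μ α) (hxy : x ⋖ y) {b : skewDiagram μ α}
    (hbx : b.1 ∉ x.1.cells) (hby : b.1 ∈ y.1.cells) :
    tableauLabeling T x y hxy = T.entry b := by
  have h := (exists_box_of_covBy hxy).choose_spec
  rw [h.2, Finset.mem_insert] at hby
  exact congrArg T.entry (Subtype.ext (hby.resolve_right hbx)).symm

/-! ### Standard tableaux -/

namespace StandardTableau

theorem entry_injective (Q : StandardTableau μ α) : Function.Injective Q.entry :=
  Set.injOn_univ.1 Q.bijOn.injOn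

theorem entry_mem (Q : StandardTableau μ α) (b : skewDiagram μ α) :
    Q.entry b ∈ Set.Icc 1 (skewDiagram μ α).card :=
  Q.bijOn.mapsTo (Set.mem_univ b)

theorem entry_mono (Q : StandardTableau μ α) {b c : skewDiagram μ α} (h : b.1 ≤ c.1) :
    Q.entry b ≤ Q.entry c := by
  have hα := (Finset.mem_sdiff.1 c.2).1
  have hμ := (Finset.mem_sdiff.1 b.2).2
  -- The corner in the row of `b` and the column of `c` lies in the skew shape, since it is below
  -- `c` in `α` and above `b`, which is outside `μ`.
  let d : skewDiagram μ α := ⟨(b.1.1, c.1.2), Finset.mem_sdiff.2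
    ⟨α.isLowerSet (Prod.mk_le_mk.2 ⟨h.1, le_rfl⟩ : (b.1.1, c.1.2) ≤ (c.1.1, c.1.2)) hα,
      fun hd => hμ (μ.isLowerSet (Prod.mk_le_mk.2 ⟨le_rfl, h.2⟩ :
        (b.1.1, b.1.2) ≤ (b.1.1, c.1.2)) hd)⟩⟩
  have h1 : Q.entry b ≤ Q.entry d := by
    rcases h.2.eq_or_lt with he | hlt
    · exact le_of_eq (congrArg Q.entry (Subtype.ext (Prod.ext rfl he)))
    · exact (Q.row_strict b d rfl hlt).le
  have h2 : Q.entry d ≤ Q.entry c := by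
    rcases h.1.eq_or_lt with he | hlt
    · exact le_of_eq (congrArg Q.entry (Subtype.ext (Prod.ext he rfl)))
    · exact (Q.col_strict d c rfl hlt).le
  exact h1.trans h2

/-- An entry is its own rank, so a tableau is determined by the order it puts on the boxes. -/
theorem ncard_entry_le (Q : StandardTableau μ α) (b : skewDiagram μ α) :
    {c | Q.entry c ≤ Q.entry b}.ncard = Q.entry b := by
  rw [← Set.ncard_image_of_injective _ Q.entry_injective]
  have : Q.entry '' {c | Q.entry c ≤ Q.entry b} = Finset.Icc 1 (Q.entry b) := by
    ext k
    simp only [Set.mem_image, Set.mem_ofPred_eq, Finset.coe_Icc, Set.mem_Icc]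
    constructor
    · rintro ⟨c, hc, rfl⟩
      exact ⟨(Q.entry_mem c).1, hc⟩
    · rintro ⟨h1, h2⟩
      obtain ⟨c, -, rfl⟩ := Q.bijOn.surjOn ⟨h1, h2.trans (Q.entry_mem b).2⟩
      exact ⟨c, h2, rfl⟩
  rw [this, Set.ncard_coe_finset, Nat.card_Icc]
  omega

theorem ext_of_lt_iff {Q R : StandardTableau μ α}
    (h : ∀ b c, Q.entry b < Q.entry c ↔ R.entry b < R.entry c) : Q = R := by
  ext b
  rw [← Q.ncard_entry_le, ← R.ncard_entry_le]
  congr 1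
  ext c
  simp only [Set.mem_ofPred_eq, ← not_lt, h]

open Classical in
/-- The diagram obtained from `x` by adding the boxes of `y` with entry at most `k`. -/
noncomputable def truncation (Q : StandardTableau μ α) (x y : Set.Icc μ α) (k : ℕ) :
    Set.Icc μ α :=
  ⟨⟨x.1.cells ∪ y.1.cells.filter
      (fun p => ∃ hp : p ∈ skewDiagram μ α, Q.entry ⟨p, hp⟩ ≤ k), by
    intro p q hqp hp
    simp only [Finset.coe_union, Finset.coe_filter, Set.mem_union, Finset.mem_coe,
      Set.mem_ofPred_eq] at hp ⊢
    rcases hp with hp | ⟨hpy, hps, hpk⟩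
    · exact Or.inl (x.1.isLowerSet hqp hp)
    · by_cases hqx : q ∈ x.1.cells
      · exact Or.inl hqx
      · have hqy : q ∈ y.1.cells := y.1.isLowerSet hqp hpy
        have hqs : q ∈ skewDiagram μ α := Finset.mem_sdiff.2 ⟨y.2.2 hqy, fun h => hqx (x.2.1 h)⟩
        exact Or.inr ⟨hqy, hqs,
          (Q.entry_mono (b := ⟨q, hqs⟩) (c := ⟨p, hps⟩) hqp).trans hpk⟩⟩,
    (show μ.cells ⊆ x.1.cells from x.2.1).trans Finset.subset_union_left,
    Finset.union_subset x.2.2 ((Finset.filter_subset _ _).trans y.2.2)⟩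

theorem mem_truncation (Q : StandardTableau μ α) (x y : Set.Icc μ α) (k : ℕ)
    (b : skewDiagram μ α) : b.1 ∈ (Q.truncation x y k).1.cells ↔
      b.1 ∈ x.1.cells ∨ b.1 ∈ y.1.cells ∧ Q.entry b ≤ k := by
  simp only [truncation, Finset.mem_union, Finset.mem_filter]
  exact or_congr_right (and_congr_right fun _ => ⟨fun ⟨_, h⟩ => h, fun h => ⟨b.2, h⟩⟩)

/-- The elements of `[x, y]` obtained from `x` by adding boxes in the order of their entries. -/
def initialChain (Q : StandardTableau μ α) (x y : Set.Icc μ α) : Set (Set.Icc μ α) :=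
  {z | z ∈ Set.Icc x y ∧ ∀ b c : skewDiagram μ α, b.1 ∉ x.1.cells → b.1 ∈ z.1.cells →
    c.1 ∈ y.1.cells → c.1 ∉ z.1.cells → Q.entry b < Q.entry c}

theorem truncation_mem_initialChain (Q : StandardTableau μ α) (hxy : x ≤ y) (k : ℕ) :
    Q.truncation x y k ∈ Q.initialChain x y := by
  refine ⟨⟨le_iff_boxes.2 fun b hb => (Q.mem_truncation x y k b).2 (Or.inl hb),
    le_iff_boxes.2 fun b hb => ?_⟩, fun b c hbx hb hcy hc => ?_⟩
  · exact ((Q.mem_truncation x y k b).1 hb).elim (fun h => hxy h) And.left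
  · rw [mem_truncation] at hb hc
    push Not at hc
    exact (hb.resolve_left hbx).2.trans_lt (hc.2 hcy)

/-- Two incomparable elements would each own a box missing from the other, forcing two opposite
inequalities of entries. Maximality holds because the truncations already suffice to test
membership. -/
theorem isMaxChainOf_initialChain (Q : StandardTableau μ α) (hxy : x ≤ y) :
    IsMaxChainOf x y (Q.initialChain x y) := by
  refine ⟨⟨fun z hz => hz.1, fun z hz t ht _ => ?_⟩, ?_⟩
  · by_contra hcon
    push Not at hcon
    obtain ⟨b, hbz, hbt⟩ := exists_box_of_not_le hcon.1
    obtain ⟨c, hct, hcz⟩ := exists_box_of_not_le hcon.2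
    have h1 := hz.2 b c (fun h => hbt (ht.1.1 h)) hbz (ht.1.2 hct) hcz
    have h2 := ht.2 c b (fun h => hcz (hz.1.1 h)) hct (hz.1.2 hbz) hbt
    exact absurd h1 h2.le.not_gt
  · rintro s ⟨hs, hchain⟩ hsub z hz
    refine ⟨hs hz, fun b c hbx hbz hcy hcz => ?_⟩
    by_contra hcon
    have hlt : Q.entry c < Q.entry b := lt_of_le_of_ne (not_lt.1 hcon) fun h =>
      hcz (Q.entry_injective h ▸ hbz)
    -- The truncation at `Q.entry c` contains `c` but not `b`, while `z` contains `b` but not `c`;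
    -- so they are incomparable.
    rcases hchain.total hz (hsub (Q.truncation_mem_initialChain hxy (Q.entry c))) with h | h
    · rcases (Q.mem_truncation _ _ _ b).1 (h hbz) with h' | h'
      · exact hbx h'
      · exact absurd h'.2 hlt.not_ge
    · exact hcz (h ((Q.mem_truncation _ _ _ c).2 (Or.inr ⟨hcy, le_rfl⟩)))

end StandardTableau

/-! ### The EL-labeling -/

theorem isAscending_initialChain (T : StandardTableau μ α) :
    IsAscending (tableauLabeling T) (T.initialChain x y) := by
  intro u v w huv hvw hu hv hw
  obtain ⟨b, hbu, hb⟩ := exists_box_iff_of_covBy huv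
  obtain ⟨c, hcv, hc⟩ := exists_box_iff_of_covBy hvw
  have hbv := (hb b).2 (Or.inl rfl)
  have hcw := (hc c).2 (Or.inl rfl)
  rw [tableauLabeling_eq T huv hbu hbv, tableauLabeling_eq T hvw hcv hcw]
  exact (hv.2 b c (fun h => hbu (hu.1.1 h)) hbv (hw.1.2 hcw) hcv).le

/-- The step of a maximal chain of `[x, y]` in which a given box is added. -/
theorem IsMaxChainOf.exists_step {d : Set (Set.Icc μ α)} (hd : IsMaxChainOf x y d)
    {s t : Set.Icc μ α} (hs : s ∈ d) (ht : t ∈ d) {b : skewDiagram μ α} (hbs : b.1 ∉ s.1.cells)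
    (hbt : b.1 ∈ t.1.cells) :
    ∃ u ∈ d, ∃ v ∈ d, u ⋖ v ∧ s ≤ u ∧ v ≤ t ∧ b.1 ∉ u.1.cells ∧ b.1 ∈ v.1.cells := by
  have := finite_interval μ α
  obtain ⟨u, hu⟩ := (Set.toFinite {u | u ∈ d ∧ s ≤ u ∧ b.1 ∉ u.1.cells}).exists_maximal
    ⟨s, hs, le_rfl, hbs⟩
  obtain ⟨hud, hsu, hbu⟩ := hu.1
  have hut : u < t := by
    rcases hd.le_or_le hud ht with h | h
    · exact lt_of_le_of_ne h (by rintro rfl; exact hbu hbt)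
    · exact absurd (h hbt) hbu
  obtain ⟨v, hv, huv, hvt⟩ := hd.exists_covBy hud ht hut
  refine ⟨u, hud, v, hv, huv, hsu, hvt, hbu, ?_⟩
  by_contra hbv
  exact absurd (hu.2 ⟨hv, hsu.trans huv.le, hbv⟩ huv.le) (not_le_of_gt huv.lt)

/-- A box of `z` is added before `z` is reached and a missing box after it, so ascending labels
order their entries. This puts `d` inside `initialChain`, and maximality gives equality. -/
theorem IsMaxChainOf.eq_initialChain (T : StandardTableau μ α) (hxy : x ≤ y)
    {d : Set (Set.Icc μ α)} (hd : IsMaxChainOf x y d) (hasc : IsAscending (tableauLabeling T) d) :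
    d = T.initialChain x y := by
  have := finite_interval μ α
  refine hd.eq_of_subset (T.isMaxChainOf_initialChain hxy) fun z hz =>
    ⟨hd.1.1 hz, fun b c hbx hbz hcy hcz => ?_⟩
  obtain ⟨u, hu, v, hv, huv, -, hvz, hbu, hbv⟩ := hd.exists_step (hd.left_mem hxy) hz hbx hbz
  obtain ⟨s, hs, t, ht, hst, hzs, -, hcs, hct⟩ := hd.exists_step hz (hd.right_mem hxy) hcz hcy
  have hle := hasc.label_le hd huv hu hv hst hs ht (hvz.trans hzs)
  rw [tableauLabeling_eq T huv hbu hbv, tableauLabeling_eq T hst hcs hct] at hle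
  exact lt_of_le_of_ne hle fun h => hcz (T.entry_injective h ▸ hbz)

theorem isELLabeling_tableauLabeling (T : StandardTableau μ α) :
    IsELLabeling (tableauLabeling T) := by
  intro x y hxy
  have := finite_interval μ α
  have hmax := T.isMaxChainOf_initialChain hxy.le
  refine ⟨_, ⟨hmax, isAscending_initialChain T, fun d hd hasc => hd.eq_initialChain T hxy.le hasc⟩,
    fun d hd hne => ?_⟩
  obtain ⟨u, huc, hud, hagree, v, hv, v', hv', huv, huv', hvv'⟩ :=
    hmax.exists_branching hxy.le hd hne
  refine LexPrecedes.of_branching hmax hd huc hud hagree hv hv' huv huv' ?_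
  obtain ⟨b, hbu, hb⟩ := exists_box_iff_of_covBy huv
  obtain ⟨c, hcu, hc⟩ := exists_box_iff_of_covBy huv'
  have hbv := (hb b).2 (Or.inl rfl)
  have hcv' := (hc c).2 (Or.inl rfl)
  have hcv : c.1 ∉ v.1.cells := by
    intro h
    obtain rfl := ((hb c).1 h).resolve_right hcu
    exact hvv' (eq_iff_boxes.2 fun e => (hb e).trans (hc e).symm)
  rw [tableauLabeling_eq T huv hbu hbv, tableauLabeling_eq T huv' hcu hcv']
  -- At `v` the box `b` is present and `c`, a box of `y`, is still missing; membership of `v` in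
  -- `initialChain` compares their entries.
  exact hv.2 b c (fun h => hbu (huc.1.1 h)) hbv ((hd.1.1 hv').2 hcv') hcv

/-! ### Maximal chains and standard tableaux -/

/-- The maximal chain of `[μ, α]` that adds boxes in the order of their entries. -/
def StandardTableau.toFlag (h : μ ≤ α) (Q : StandardTableau μ α) : Flag (Set.Icc μ α) where
  carrier := Q.initialChain ⟨μ, le_refl μ, h⟩ ⟨α, h, le_refl α⟩
  Chain' := (Q.isMaxChainOf_initialChain (show _ ≤ _ from h)).1.2
  max_chain' := fun _ hs hsub => hsub.antisymm
    ((Q.isMaxChainOf_initialChain (show _ ≤ _ from h)).2 ⟨fun z _ => z.2, hs⟩ hsub)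

theorem StandardTableau.mem_toFlag (h : μ ≤ α) (Q : StandardTableau μ α) {z : Set.Icc μ α} :
    z ∈ Q.toFlag h ↔ ∀ b c : skewDiagram μ α, b.1 ∈ z.1.cells → c.1 ∉ z.1.cells →
      Q.entry b < Q.entry c :=
  ⟨fun hz b c hb hc => hz.2 b c (Finset.mem_sdiff.1 b.2).2 hb (Finset.mem_sdiff.1 c.2).1 hc,
    fun hz => ⟨z.2, fun b c _ hb _ hc => hz b c hb hc⟩⟩

theorem toFlag_chainTableau (h : μ ≤ α) (m : Flag (Set.Icc μ α)) :
    (chainTableau h m).toFlag h = m := by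
  refine (Flag.ext (m.maxChain.2 ((chainTableau h m).toFlag h).chain_le fun z hz => ?_)).symm
  exact ((chainTableau h m).mem_toFlag h).2 fun b c hb hc => chainEntry_lt m hz hb hc

theorem mem_iff_chainEntry (h : μ ≤ α) {m : Flag (Set.Icc μ α)} {z : Set.Icc μ α} :
    z ∈ m ↔ ∀ b c : skewDiagram μ α, b.1 ∈ z.1.cells → c.1 ∉ z.1.cells →
      chainEntry m b < chainEntry m c := by
  conv_lhs => rw [← toFlag_chainTableau h m]
  exact (chainTableau h m).mem_toFlag h

/-- Only the order of the entries matters. A chain element separating two boxes orders them in the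
same way for both tableaux, and totality turns one implication into an equivalence. -/
theorem chainTableau_toFlag (h : μ ≤ α) (Q : StandardTableau μ α) :
    chainTableau h (Q.toFlag h) = Q := by
  have key : ∀ b c, chainEntry (Q.toFlag h) b < chainEntry (Q.toFlag h) c →
      Q.entry b < Q.entry c := by
    intro b c hlt
    obtain ⟨x, hx, h1 | h1⟩ := exists_separating h (Q.toFlag h) (b := b) (c := c)
      (by rintro rfl; exact lt_irrefl _ hlt)
    · exact (Q.mem_toFlag h).1 hx b c h1.1 h1.2
    · exact absurd (chainEntry_lt _ hx h1.1 h1.2) hlt.not_gt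
  refine StandardTableau.ext_of_lt_iff fun b c => ⟨key b c, fun hlt => ?_⟩
  by_contra hcon
  rcases (not_lt.1 hcon).eq_or_lt with heq | hlt'
  · rw [chainEntry_injective h _ heq] at hlt
    exact lt_irrefl _ hlt
  · exact absurd (key c b hlt') hlt.not_gt

/-- The bijection from maximal chains of `[μ, α]` to standard tableaux of shape `α / μ`. -/
noncomputable def chainTableauEquiv (h : μ ≤ α) :
    Flag (Set.Icc μ α) ≃ StandardTableau μ α where
  toFun := chainTableau h
  invFun := StandardTableau.toFlag h
  left_inv := toFlag_chainTableau h
  right_inv := chainTableau_toFlag h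

/-! ### Polygon moves and tableau swaps -/

open Classical in
-- Isolates the contribution of one chain element, in order to compare two chains that differ in a
-- single element.
theorem chainEntry_eq_ncard_add {m : Flag (Set.Icc μ α)} (hx : x ∈ m) (b : skewDiagram μ α) :
    chainEntry m b = {z | z ∈ (m : Set (Set.Icc μ α)) \ {x} ∧ b.1 ∉ z.1.cells}.ncard +
      if b.1 ∈ x.1.cells then 0 else 1 := by
  have := finite_interval μ α
  unfold chainEntry
  split_ifs with hb
  · rw [add_zero]
    congr 1
    ext z
    simp only [Set.mem_ofPred_eq, Set.mem_sdiff, SetLike.mem_coe, Set.mem_singleton_iff]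
    exact ⟨fun hz => ⟨⟨hz.1, by rintro rfl; exact hz.2 hb⟩, hz.2⟩, fun hz => ⟨hz.1.1, hz.2⟩⟩
  · rw [← Set.ncard_insert_of_notMem (a := x) (fun hz => hz.1.2 rfl) (Set.toFinite _)]
    congr 1
    ext z
    simp only [Set.mem_ofPred_eq, Set.mem_sdiff, SetLike.mem_coe, Set.mem_singleton_iff,
      Set.mem_insert_iff]
    constructor
    · intro hz
      by_cases hzx : z = x
      · exact Or.inl hzx
      · exact Or.inr ⟨⟨hz.1, hzx⟩, hz.2⟩
    · rintro (rfl | hz)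
      exacts [⟨hx, hb⟩, ⟨hz.1.1, hz.2⟩]

theorem box_eq {Q : StandardTableau μ α} {i : ℕ} (hi : i ∈ Set.Icc 1 (skewDiagram μ α).card)
    {b : skewDiagram μ α} (hb : Q.entry b = i) : Q.box i hi = b :=
  Q.entry_injective ((Q.entry_box i hi).trans hb.symm)

theorem tableauMove_iff {T Q R : StandardTableau μ α} :
    TableauMove T Q R ↔ ∃ b c, Q.entry c = Q.entry b + 1 ∧ T.entry b < T.entry c ∧
      IsTableauSwap (Q.entry b) (Q.entry b + 1) Q R := by
  constructor
  · rintro ⟨i, hi, hi', hlt, hswap⟩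
    refine ⟨_, _, ?_, hlt, ?_⟩
    · rw [Q.entry_box, Q.entry_box]
    · rwa [Q.entry_box]
  · rintro ⟨b, c, hbc, hlt, hswap⟩
    refine ⟨_, Q.entry_mem b, hbc ▸ Q.entry_mem c, ?_, hswap⟩
    rwa [box_eq _ rfl, box_eq _ hbc]

theorem PolygonMove.tableauMove (h : μ ≤ α) {T : StandardTableau μ α} {m m' : Flag (Set.Icc μ α)}
    (hm : PolygonMove (tableauLabeling T) m m') :
    TableauMove T (chainTableau h m) (chainTableau h m') := by
  classical
  obtain ⟨w, x', z, hwx', hx'z, ⟨hw, hz, hw', hx', hz', -, -, hx'm, hlow, hupp⟩, -, hlab⟩ := hm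
  obtain ⟨c, hcw, hc⟩ := exists_box_iff_of_covBy hwx'
  obtain ⟨b, hbx', hb⟩ := exists_box_iff_of_covBy hx'z
  rw [tableauLabeling_eq T hwx' hcw ((hc c).2 (Or.inl rfl)),
    tableauLabeling_eq T hx'z hbx' ((hb b).2 (Or.inl rfl)), not_le] at hlab
  have hbc : b ≠ c := by
    rintro rfl
    exact lt_irrefl _ hlab
  have hbw : b.1 ∉ w.1.cells := fun hb' => hbx' (hwx'.le hb')
  have hbz : b.1 ∈ z.1.cells := (hb b).2 (Or.inl rfl)
  have hcx' : c.1 ∈ x'.1.cells := (hc c).2 (Or.inl rfl)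
  have hcz : c.1 ∈ z.1.cells := hx'z.le hcx'
  -- An element of `m` separating `b` from `c` must lie between `w`, which has neither box, and `z`,
  -- which has both. It is `w ∪ {b}`, because the other possibility is `x'`, which is not in `m`.
  obtain ⟨x, hx, hsep⟩ := exists_separating h m hbc
  have hwx : w ≤ x := (m.le_or_le hw hx).elim id fun hle => by
    rcases hsep with hsep | hsep
    exacts [absurd (hle hsep.1) hbw, absurd (hle hsep.1) hcw]
  have hxz : x ≤ z := (m.le_or_le hx hz).elim id fun hle => by
    rcases hsep with hsep | hsep
    exacts [absurd (hle hcz) hsep.2, absurd (hle hbz) hsep.2]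
  have hsep' : b.1 ∈ x.1.cells ∧ c.1 ∉ x.1.cells := by
    refine hsep.resolve_right fun hs => hx'm ?_
    have : x' = x := eq_iff_boxes.2 fun d => by
      rw [hc]
      constructor
      · rintro (rfl | hd)
        exacts [hs.1, hwx hd]
      · intro hd
        rcases (hb d).1 (hxz hd) with rfl | hd'
        exacts [absurd hd hs.2, (hc d).1 hd']
    rwa [this]
  have hxbox : ∀ d : skewDiagram μ α, d.1 ∈ x.1.cells ↔ d = b ∨ d.1 ∈ w.1.cells := by
    intro d
    constructor
    · intro hd
      rcases (hb d).1 (hxz hd) with rfl | hd'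
      · exact Or.inl rfl
      · rcases (hc d).1 hd' with rfl | hd''
        exacts [absurd hd hsep'.2, Or.inr hd'']
    · rintro (rfl | hd)
      exacts [hsep'.1, hwx hd]
  have hwx_cov : w ⋖ x := covBy_of_boxes hbw hxbox
  have hxz_cov : x ⋖ z := by
    refine covBy_of_boxes hsep'.2 fun d => ?_
    rw [hb, hc, hxbox]
    tauto
  have hlow' : ∀ t ≤ w, t ∈ m ↔ t ∈ m' := fun t ht =>
    ⟨fun hh => (hlow.le ⟨hh, ht⟩).1, fun hh => (hlow.ge ⟨hh, ht⟩).1⟩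
  have hupp' : ∀ t, z ≤ t → (t ∈ m ↔ t ∈ m') := fun t ht =>
    ⟨fun hh => (hupp.le ⟨hh, ht⟩).1, fun hh => (hupp.ge ⟨hh, ht⟩).1⟩
  have hsplit : ∀ t ∈ (m : Set (Set.Icc μ α)) \ {x}, t ≤ w ∨ z ≤ t := fun t ht =>
    le_or_le_of_covBy_covBy m hw hx hz hwx_cov hxz_cov ht.1 ht.2
  have hcommon : (m : Set (Set.Icc μ α)) \ {x} = (m' : Set (Set.Icc μ α)) \ {x'} := by
    ext t
    constructor
    · intro ht
      refine ⟨?_, fun he => hx'm (Set.mem_singleton_iff.1 he ▸ ht.1)⟩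
      exact (hsplit t ht).elim (fun hh => (hlow' t hh).1 ht.1) fun hh => (hupp' t hh).1 ht.1
    · intro ht
      have hor := le_or_le_of_covBy_covBy m' hw' hx' hz' hwx' hx'z ht.1 ht.2
      refine ⟨hor.elim (fun hh => (hlow' t hh).2 ht.1) fun hh => (hupp' t hh).2 ht.1, ?_⟩
      rintro rfl
      exact hor.elim (fun hh => not_le_of_gt hwx_cov.lt hh) fun hh => not_le_of_gt hxz_cov.lt hh
  -- Away from `x` the chain does not distinguish `b` from `c`, so their entries differ only by the
  -- contribution of `x`.
  have hcount : {t | t ∈ (m : Set (Set.Icc μ α)) \ {x} ∧ b.1 ∉ t.1.cells} =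
      {t | t ∈ (m : Set (Set.Icc μ α)) \ {x} ∧ c.1 ∉ t.1.cells} := by
    ext t
    refine and_congr_right fun ht => ?_
    rcases hsplit t ht with hh | hh
    · exact ⟨fun _ hc' => hcw (hh hc'), fun _ hb' => hbw (hh hb')⟩
    · exact ⟨fun hn => absurd (hh hbz) hn, fun hn => absurd (hh hcz) hn⟩
  have e1 := fun d => chainEntry_eq_ncard_add hx d
  have e2 := fun d => chainEntry_eq_ncard_add hx' d
  rw [← hcommon] at e2
  have hcb : chainEntry m c = chainEntry m b + 1 := by
    rw [e1, e1, hcount, if_neg hsep'.2, if_pos hsep'.1]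
  refine tableauMove_iff.2 ⟨b, c, hcb, hlab, fun d => ?_⟩
  change chainEntry m' d = Equiv.swap (chainEntry m b) (chainEntry m b + 1) (chainEntry m d)
  by_cases hdb : d = b
  · subst hdb
    rw [Equiv.swap_apply_left, e1, e2, if_pos hsep'.1, if_neg hbx']
  by_cases hdc : d = c
  · subst hdc
    rw [← hcb, Equiv.swap_apply_right, e1, e2, hcount, if_pos hcx', if_pos hsep'.1]
  rw [← hcb, Equiv.swap_apply_of_ne_of_ne (fun he => hdb (chainEntry_injective h m he))
    (fun he => hdc (chainEntry_injective h m he)), e1, e2]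
  congr 1
  simp only [hxbox, hc, hdb, hdc, false_or]

/-- The swap preserves every initial segment of the numbers except the one that ends at `i`, which
is why the two chains differ in only one element. -/
theorem swap_succ_le_iff {i a k : ℕ} (hk : k ≠ i) :
    Equiv.swap i (i + 1) a ≤ k ↔ a ≤ k := by
  rw [Equiv.swap_apply_def]
  split_ifs <;> omega

theorem TableauMove.polygonMove (h : μ ≤ α) {T : StandardTableau μ α}
    {m m' : Flag (Set.Icc μ α)} (hm : TableauMove T (chainTableau h m) (chainTableau h m')) :
    PolygonMove (tableauLabeling T) m m' := by
  obtain ⟨b, c, hcb, hlt, hswap⟩ := tableauMove_iff.1 hm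
  set Q := chainTableau h m with hQ
  set R := chainTableau h m' with hR
  set i := Q.entry b with hi
  have hQm : ∀ {t}, t ∈ m ↔ ∀ d e : skewDiagram μ α, d.1 ∈ t.1.cells → e.1 ∉ t.1.cells →
      Q.entry d < Q.entry e := mem_iff_chainEntry h
  have hRm : ∀ {t}, t ∈ m' ↔ ∀ d e : skewDiagram μ α, d.1 ∈ t.1.cells → e.1 ∉ t.1.cells →
      R.entry d < R.entry e := mem_iff_chainEntry h
  have hi1 : 1 ≤ i := (Q.entry_mem b).1
  have hQb : ∀ d, Q.entry d = i ↔ d = b := fun d =>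
    ⟨fun he => Q.entry_injective he, fun he => he ▸ rfl⟩
  have hQc : ∀ d, Q.entry d = i + 1 ↔ d = c := fun d =>
    ⟨fun he => Q.entry_injective (he.trans hcb.symm), fun he => he ▸ hcb⟩
  let lo : Set.Icc μ α := ⟨μ, le_refl μ, h⟩
  let hi' : Set.Icc μ α := ⟨α, h, le_refl α⟩
  have hmem : ∀ (S : StandardTableau μ α) (k : ℕ) (d : skewDiagram μ α),
      d.1 ∈ (S.truncation lo hi' k).1.cells ↔ S.entry d ≤ k := by
    intro S k d
    rw [S.mem_truncation]
    have h1 : d.1 ∉ lo.1.cells := (Finset.mem_sdiff.1 d.2).2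
    have h2 : d.1 ∈ hi'.1.cells := (Finset.mem_sdiff.1 d.2).1
    tauto
  -- The polygon consists of the diagrams just before, between and after the additions numbered `i`
  -- and `i + 1`; `x'` is the middle one for `R`.
  obtain ⟨w, hwdef⟩ : ∃ w, w = Q.truncation lo hi' (i - 1) := ⟨_, rfl⟩
  obtain ⟨x, hxdef⟩ : ∃ x, x = Q.truncation lo hi' i := ⟨_, rfl⟩
  obtain ⟨z, hzdef⟩ : ∃ z, z = Q.truncation lo hi' (i + 1) := ⟨_, rfl⟩
  obtain ⟨x', hx'def⟩ : ∃ x', x' = R.truncation lo hi' i := ⟨_, rfl⟩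
  have hw : ∀ d : skewDiagram μ α, d.1 ∈ w.1.cells ↔ Q.entry d ≤ i - 1 := by
    rw [hwdef]; exact hmem Q _
  have hx : ∀ d : skewDiagram μ α, d.1 ∈ x.1.cells ↔ d = b ∨ d.1 ∈ w.1.cells := by
    intro d; rw [hxdef, hmem, hw, ← hQb]; omega
  have hz : ∀ d : skewDiagram μ α, d.1 ∈ z.1.cells ↔ Q.entry d ≤ i + 1 := by
    rw [hzdef]; exact hmem Q _
  have hx' : ∀ d : skewDiagram μ α, d.1 ∈ x'.1.cells ↔ d = c ∨ d.1 ∈ w.1.cells := by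
    intro d
    rw [hx'def, hmem, hw, ← hQc, hswap d, Equiv.swap_apply_def]
    split_ifs <;> omega
  have hzx : ∀ d : skewDiagram μ α, d.1 ∈ z.1.cells ↔ d = c ∨ d.1 ∈ x.1.cells := by
    intro d; rw [hz, hx, hw, ← hQb, ← hQc]; omega
  have hzx' : ∀ d : skewDiagram μ α, d.1 ∈ z.1.cells ↔ d = b ∨ d.1 ∈ x'.1.cells := by
    intro d; rw [hz, hx', hw, ← hQb, ← hQc]; omega
  have hbc : b ≠ c := by rintro rfl; exact lt_irrefl _ hlt
  have hbw : b.1 ∉ w.1.cells := by rw [hw]; omega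
  have hcw : c.1 ∉ w.1.cells := by rw [hw]; omega
  have hcx : c.1 ∉ x.1.cells := by rw [hx]; exact fun hh => hh.elim hbc.symm hcw
  have hbx' : b.1 ∉ x'.1.cells := by rw [hx']; exact fun hh => hh.elim hbc hbw
  have hbx : b.1 ∈ x.1.cells := (hx b).2 (Or.inl rfl)
  have hcx' : c.1 ∈ x'.1.cells := (hx' c).2 (Or.inl rfl)
  have hwx_cov : w ⋖ x := covBy_of_boxes hbw hx
  have hxz_cov : x ⋖ z := covBy_of_boxes hcx hzx
  have hwx'_cov : w ⋖ x' := covBy_of_boxes hcw hx'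
  have hx'z_cov : x' ⋖ z := covBy_of_boxes hbx' hzx'
  have hbz : b.1 ∈ z.1.cells := hxz_cov.le hbx
  have hcz : c.1 ∈ z.1.cells := hx'z_cov.le hcx'
  have htrunc : ∀ (k : ℕ), Q.truncation lo hi' k ∈ m := fun k => hQm.2 fun d e hd he => by
    rw [hmem] at hd he; omega
  have htrunc' : ∀ (k : ℕ), R.truncation lo hi' k ∈ m' := fun k => hRm.2 fun d e hd he => by
    rw [hmem] at hd he; omega
  have hwm : w ∈ m := hwdef ▸ htrunc _
  have hxm : x ∈ m := hxdef ▸ htrunc _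
  have hzm : z ∈ m := hzdef ▸ htrunc _
  have hx'm' : x' ∈ m' := hx'def ▸ htrunc' _
  have hx'm : x' ∉ m := fun hh => by
    have := hQm.1 hh c b hcx' hbx'
    omega
  have hlow : ∀ t ≤ w, t ∈ m ↔ t ∈ m' := by
    intro t ht
    rw [hQm, hRm]
    -- Boxes of `t` have entries below `i`: the swap fixes them and does not change which entries
    -- exceed them.
    refine forall_congr' fun d => forall_congr' fun e => forall_congr' fun hd =>
      forall_congr' fun _ => ?_
    have := (hw d).1 (ht hd)
    rw [hswap d, hswap e, ← not_le, ← not_le,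
      Equiv.swap_apply_of_ne_of_ne (x := Q.entry d) (by omega) (by omega),
      swap_succ_le_iff (by omega)]
  have hupp : ∀ t, z ≤ t → (t ∈ m ↔ t ∈ m') := by
    intro t ht
    rw [hQm, hRm]
    refine forall_congr' fun d => forall_congr' fun e => forall_congr' fun _ =>
      forall_congr' fun he => ?_
    have : ¬ Q.entry e ≤ i + 1 := fun hh => he (ht ((hz e).2 hh))
    rw [hswap d, hswap e,
      Equiv.swap_apply_of_ne_of_ne (x := Q.entry e) (by omega) (by omega),
      Equiv.swap_apply_def]
    split_ifs <;> omega
  have hwz : w ≤ z := hwx_cov.le.trans hxz_cov.le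
  have hmax := isMaxChainOf_inter_Icc m hwm hzm
  have hlab : ¬ tableauLabeling T w x' hwx'_cov ≤ tableauLabeling T x' z hx'z_cov := by
    rw [tableauLabeling_eq T hwx'_cov hcw hcx', tableauLabeling_eq T hx'z_cov hbx' hbz]
    exact not_le_of_gt hlt
  refine ⟨w, x', z, hwx'_cov, hx'z_cov, ⟨hwm, hzm, (hlow w le_rfl).1 hwm, hx'm',
    (hupp z le_rfl).1 hzm, hwx'_cov, hx'z_cov, hx'm, ?_, ?_⟩, ⟨hmax, ?_, ?_⟩, hlab⟩
  · exact Set.ext fun t => and_congr_left fun ht => hlow t ht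
  · exact Set.ext fun t => and_congr_left fun ht => hupp t ht
  · have hcases : ∀ t ∈ (m : Set (Set.Icc μ α)) ∩ Set.Icc w z, t ≠ x → t = w ∨ t = z :=
      fun t ht htx => (le_or_le_of_covBy_covBy m hwm hxm hzm hwx_cov hxz_cov ht.1 htx).imp
        (fun hh => hh.antisymm ht.2.1) fun hh => ht.2.2.antisymm hh
    intro u v t huv hvt hu hv ht
    obtain rfl : v = x := by
      by_contra hvx
      rcases hcases v hv hvx with rfl | rfl
      · exact not_le_of_gt huv.lt hu.2.1
      · exact not_le_of_gt hvt.lt ht.2.2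
    obtain rfl : u = w := (hcases u hu huv.lt.ne).resolve_right
      fun hh => not_le_of_gt huv.lt (hh ▸ hxz_cov.le)
    obtain rfl : t = z := (hcases t ht hvt.lt.ne').resolve_left
      fun hh => not_le_of_gt hvt.lt (hh ▸ hwx_cov.le)
    rw [tableauLabeling_eq T huv hbw hbx, tableauLabeling_eq T hvt hcx hcz]
    exact hlt.le
  · intro d hd hasc
    refine hd.eq_of_subset hmax fun t ht => ⟨?_, hd.1.1 ht⟩
    -- The interval `[w, z]` is `{w, x, x', z}`, and `x'` is excluded by its descent; an ascending
    -- chain therefore stays inside `m`.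
    have hx'd : x' ∉ d := fun hh =>
      hlab (hasc w x' z hwx'_cov hx'z_cov (hd.left_mem hwz) hh (hd.right_mem hwz))
    obtain ⟨htw, htz⟩ := hd.1.1 ht
    by_cases hbt : b.1 ∈ t.1.cells
    · by_cases hct : c.1 ∈ t.1.cells
      · have : t = z := htz.antisymm (le_iff_boxes.2 fun e he => by
          rcases (hzx e).1 he with rfl | he
          · exact hct
          rcases (hx e).1 he with rfl | he
          exacts [hbt, htw he])
        exact this ▸ hzm
      · have : t = x := eq_iff_boxes.2 fun e => by
          constructor
          · intro he
            rcases (hzx e).1 (htz he) with rfl | he'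
            exacts [absurd he hct, he']
          · intro he
            rcases (hx e).1 he with rfl | he
            exacts [hbt, htw he]
        exact this ▸ hxm
    · by_cases hct : c.1 ∈ t.1.cells
      · refine absurd ?_ hx'd
        have : t = x' := eq_iff_boxes.2 fun e => by
          constructor
          · intro he
            rcases (hzx' e).1 (htz he) with rfl | he'
            exacts [absurd he hbt, he']
          · intro he
            rcases (hx' e).1 he with rfl | he
            exacts [hct, htw he]
        exact this ▸ ht
      · have : t = w := eq_iff_boxes.2 fun e => by
          refine ⟨fun he => ?_, fun he => htw he⟩
          rcases (hzx e).1 (htz he) with rfl | he'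
          · exact absurd he hct
          rcases (hx e).1 he' with rfl | he'
          exacts [absurd he hbt, he']
        exact this ▸ hwm

theorem polygonMove_iff_tableauMove (h : μ ≤ α) (T : StandardTableau μ α)
    (m m' : Flag (Set.Icc μ α)) : PolygonMove (tableauLabeling T) m m' ↔
      TableauMove T (chainTableau h m) (chainTableau h m') :=
  ⟨fun hm => hm.tableauMove h, fun hm => hm.polygonMove h⟩

/-! ### The partial orders -/

/-- A tableau move decreases the inner product with `T`. -/
theorem TableauMove.sum_lt {T Q R : StandardTableau μ α} (hm : TableauMove T Q R) :
    ∑ b, T.entry b * R.entry b < ∑ b, T.entry b * Q.entry b := by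
  obtain ⟨b, c, hcb, hlt, hswap⟩ := tableauMove_iff.1 hm
  have hbc : b ≠ c := by rintro rfl; exact lt_irrefl _ hlt
  have hc : c ∈ Finset.univ.erase b := Finset.mem_erase.2 ⟨hbc.symm, Finset.mem_univ c⟩
  rw [← Finset.add_sum_erase _ _ (Finset.mem_univ b), ← Finset.add_sum_erase _ _ hc,
    ← Finset.add_sum_erase _ (fun d => T.entry d * Q.entry d) (Finset.mem_univ b),
    ← Finset.add_sum_erase _ (fun d => T.entry d * Q.entry d) hc]
  have hrest : ∑ d ∈ (Finset.univ.erase b).erase c, T.entry d * R.entry d =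
      ∑ d ∈ (Finset.univ.erase b).erase c, T.entry d * Q.entry d := by
    refine Finset.sum_congr rfl fun d hd => ?_
    rw [Finset.mem_erase, Finset.mem_erase] at hd
    rw [hswap d, ← hcb, Equiv.swap_apply_of_ne_of_ne (fun he => hd.2.1 (Q.entry_injective he))
      (fun he => hd.1 (Q.entry_injective he))]
  have hRb : R.entry b = Q.entry b + 1 := by rw [hswap b, Equiv.swap_apply_left]
  have hRc : R.entry c = Q.entry b := by rw [hswap c, hcb, Equiv.swap_apply_right]
  -- Only the terms at `b` and `c` change: the first grows by `T.entry b` and the second drops by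
  -- the larger `T.entry c`.
  rw [hrest, hRb, hRc, hcb]
  simp only [mul_add, mul_one]
  omega

theorem TableauLE.eq_or_sum_lt {T Q R : StandardTableau μ α} (hle : TableauLE T Q R) :
    Q = R ∨ ∑ b, T.entry b * R.entry b < ∑ b, T.entry b * Q.entry b := by
  induction hle with
  | refl => exact Or.inl rfl
  | tail _ hm ih =>
    rcases ih with rfl | ih
    exacts [Or.inr hm.sum_lt, Or.inr (hm.sum_lt.trans ih)]

theorem isPartialOrder_tableauLE (T : StandardTableau μ α) :
    IsPartialOrder (StandardTableau μ α) (TableauLE T) where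
  refl _ := Relation.ReflTransGen.refl
  trans _ _ _ := Relation.ReflTransGen.trans
  antisymm _ _ h1 h2 := h1.eq_or_sum_lt.elim id fun hlt =>
    h2.eq_or_sum_lt.elim Eq.symm fun hlt' => absurd hlt hlt'.not_gt

theorem tableauLE_iff_descentLE (h : μ ≤ α) (T : StandardTableau μ α)
    (m m' : Flag (Set.Icc μ α)) : TableauLE T (chainTableau h m) (chainTableau h m') ↔
      DescentLE (tableauLabeling T) m m' := by
  constructor
  · intro hle
    -- Intermediate tableaux of the sequence of moves are pulled back to chains by the inverse
    -- bijection.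
    have := Relation.ReflTransGen.lift (p := PolygonMove (tableauLabeling T))
      (chainTableauEquiv h).symm (fun Q R hQR => by
        refine (polygonMove_iff_tableauMove h T _ _).2 ?_
        change TableauMove T (chainTableauEquiv h _) (chainTableauEquiv h _)
        rwa [Equiv.apply_symm_apply, Equiv.apply_symm_apply]) _ _ hle
    change DescentLE _ ((chainTableauEquiv h).symm (chainTableauEquiv h m))
      ((chainTableauEquiv h).symm (chainTableauEquiv h m')) at this
    rwa [Equiv.symm_apply_apply, Equiv.symm_apply_apply] at this
  · exact Relation.ReflTransGen.lift (p := TableauMove T) (chainTableau h)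
      (fun a b => (polygonMove_iff_tableauMove h T a b).1) m m'

/-- The isomorphism from the maximal chain descent order onto the order on standard tableaux. -/
noncomputable def descentLEIso (h : μ ≤ α) (T : StandardTableau μ α) :
    DescentLE (tableauLabeling T) ≃r TableauLE T where
  toEquiv := chainTableauEquiv h
  map_rel_iff' := tableauLE_iff_descentLE h T _ _

theorem isPartialOrder_descentLE (h : μ ≤ α) (T : StandardTableau μ α) :
    IsPartialOrder (Flag (Set.Icc μ α)) (DescentLE (tableauLabeling T)) :=
  have := isPartialOrder_tableauLE T
  (descentLEIso h T).toRelEmbedding.isPartialOrder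

end Young

end MaxChainDescent

theorem mainTheorem8 (μ α : YoungDiagram) (h : μ ≤ α)
    (T : MaxChainDescent.StandardTableau μ α) :
    MaxChainDescent.IsELLabeling (MaxChainDescent.tableauLabeling T) ∧
    IsPartialOrder (Flag (Set.Icc μ α))
      (MaxChainDescent.DescentLE (MaxChainDescent.tableauLabeling T)) ∧
    IsPartialOrder (MaxChainDescent.StandardTableau μ α) (MaxChainDescent.TableauLE T) ∧
    ∃ e : MaxChainDescent.DescentLE (MaxChainDescent.tableauLabeling T) ≃r
        MaxChainDescent.TableauLE T,
      ∀ m : Flag (Set.Icc μ α), e m = MaxChainDescent.chainTableau h m :=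
  ⟨MaxChainDescent.isELLabeling_tableauLabeling T, MaxChainDescent.isPartialOrder_descentLE h T,
    MaxChainDescent.isPartialOrder_tableauLE T, MaxChainDescent.descentLEIso h T, fun _ => rfl⟩
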